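/- All spaces are compactly generated Hausdorff; products and mapping spaces carry the compactly generated topology. **Associahedra.** For $n\ge 2$ let $K_n$ be the space of metric trees with $n$ leaves: planar rooted trees in which every vertex has at least two incoming edges, with a length in $[0,1]$ on every internal edge, a tree with an edge of length $0$ being identified with the tree obtained by collapsing that edge (quotient topology from the disjoint union of the cubes of edge-labelings). $K_0=\{\delta_0\}$ and $K_1=\{\delta_1\}$ are points; $\delta_n$ is the tree without internal edges. For $T\in K_n$, $S\in K_m$, $1\le i\le n$ and $r\in[0,1]$, $T\circ_i^r S\in K_{n+m-1}$ is obtained by grafting the root of $S$ on the $i$-th leaf of $T$, the new edge having length $r$, and $T\circ_iS=T\circ_i^1S$; grafting $\delta_1$ does nothing, and grafting $\delta_0$ erases the $i$-th leaf (a vertex left with only one incoming edge is erased, and the merged internal edge gets the maximum of the two lengths). $\overleftarrow{T}$ is obtained by reversing the edges joining the first leaf to the root, so that the first leaf becomes the root and the root becomes the last leaf. $l(T)=2(1+\sum u)$, where $u$ runs over the lengths of the internal edges between the first leaf and the root. **$A_\infty$-spaces and $A_\infty$-maps.** A (strictly unital) $A_\infty$-space is an algebra $X$ over the operad $(K_n)_{n\ge0}$,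 with continuous structure maps $M_n:K_n\times X^n\to X$. A map $f:X\to Y$ to a topological monoid is an $A_\infty$-map if there are continuous maps $f_n:K_{n+1}\times X^n\to Y$, $n\ge1$, with $f(x)=f_1(\delta_2;x)$ and, for $|\rho|,|\tau|\ge2$ (where $|\cdot|$ is the number of leaves), $k=|\rho|+|\tau|-2$, $$f_k(\rho\circ_{j+1}\tau;x_1,\dots,x_k)=f_{|\rho|-1}(\rho;x_1,\dots,x_{j-1},M_{|\tau|}(\tau;x_j,\dots,x_{j+|\tau|-1}),x_{j+|\tau|},\dots,x_k)\quad(1\le j<|\rho|),$$ $$f_k(\rho\circ_1\tau;x_1,\dots,x_k)=f_{|\tau|-1}(\tau;x_1,\dots,x_{|\tau|-1})\cdot f_{|\rho|-1}(\rho;x_{|\tau|},\dots,x_k).$$ **The usual map.** $BX=B(*,X,*)$ is the quotient of $\coprod_{n\ge0}K_{n+2}\times X^n$, with classes $[T;*,x_1,\dots,x_n,*]$, by the relations $$[\rho\circ_{i+1}\tau;x_0,\dots,x_{n+1}]=[\rho;x_0,\dots,x_{i-1},E(\tau;x_i,\dots,x_{i+|\tau|-1}),x_{i+|\tau|},\dots,x_{n+1}]$$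 for $|\rho|\ge 2$, $|\tau|\ge1$, $0\le i\le|\rho|-1$, where $x_0=x_{n+1}=*$, $E=*$ if $i=0$ or $i=|\rho|-1$, and $E=M_{|\tau|}$ otherwise. Its base point is $[\delta_2;*,*]$. $\Omega_M(BX)$ is the topological monoid of Moore loops $(\gamma,r)$: $\gamma:[0,\infty)\to BX$ is continuous and constant on $[r,\infty)$, and $\gamma(0)=\gamma(r)$ is the base point; the product is juxtaposition. The usual map $X\to\Omega_M(BX)$ sends $x$ to the loop of length $2$ given by $t\mapsto[\sigma_0(t);*,x,*]$, where $\sigma_0(t)=\delta_2\circ_2^{1-t}\delta_2$ for $0\le t\le1$, $\sigma_0(t)=\delta_2\circ_1^{t-1}\delta_2$ for $1\le t\le2$, and $\sigma_0(t)=\sigma_0(2)$ for $t\geq 2$. **Theorem.** For every $A_\infty$-space $X$ the usual map $X\to\Omega_M(BX)$ is an $A_\infty$-map. More precisely, there are continuous maps $\sigma_n:K_n\times[0,\infty)\to K_{n+1}$, $n\ge2$, such that each $\sigma(T)=\sigma_n(T,\cdot)$ is a Moore path of length $l(T)$ with $$\sigma(T)(0)=\delta_2\circ_2\overleftarrow{T},\qquad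 \sigma(T)(l(T))=\delta_2\circ_1T,\qquad \sigma(\delta_2)=\sigma_0,$$ $$\sigma(T_1\circ_iT_2)=\sigma(T_1)\circ_iT_2\ \ (1<i\le|T_1|),\qquad \sigma(T_1\circ_1T_2)=\bigl(\sigma(T_2)\circ_{|T_2|+1}\overleftarrow{T_1}\bigr)\cdot\bigl(\sigma(T_1)\circ_1T_2\bigr)$$ for $|T|, |T_1|,|T_2|\ge2$ ($\cdot$ being juxtaposition of paths), and such that the loops $f_n(T;x_1,\dots,x_n)$ of length $l(T)$ given by $$f_n(T;x_1,\dots,x_n)(t)=[\sigma(T)(t);*,x_1,\dots,x_n,*]\qquad(n\ge1)$$ are well defined and exhibit the usual map as an $A_\infty$-map. -/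

import Mathlib

open Set Topology
open scoped NNReal

universe u v

/-! ### Planar metric trees

The leaves of a planar rooted tree with `n` leaves are numbered `0, …, n - 1` from left to right.
If every vertex has at least two incoming edges, an internal edge is determined by the
set of leaves above it; this is a block `a, …, b - 1` of consecutive leaves, encoded as `(a, b)`,
with at least two leaves and not all of them.  A set of blocks is the set of internal
edges of such a tree exactly when any two of them are disjoint or nested. -/

/-- `(a, b)` is a block of at least two, but not all, of the leaves `0, …, n - 1`. -/
def IsInner (n : ℕ) (e : ℕ × ℕ) : Prop := e.1 + 2 ≤ e.2 ∧ e.2 ≤ n ∧ ¬ (e.1 = 0 ∧ e.2 = n)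

/-- Two blocks of leaves are disjoint or nested. -/
def NonCross (e e' : ℕ × ℕ) : Prop :=
  e.2 ≤ e'.1 ∨ e'.2 ≤ e.1 ∨ (e.1 ≤ e'.1 ∧ e'.2 ≤ e.2) ∨ (e'.1 ≤ e.1 ∧ e.2 ≤ e'.2)

instance (n : ℕ) (e : ℕ × ℕ) : Decidable (IsInner n e) := by unfold IsInner; infer_instance

/-- Planar rooted trees with `n` leaves, each vertex having at least two incoming edges, given by
their internal edges.  For `n = 0, 1` there is exactly one tree (the tree without leaves, and the
tree with one edge and no vertex). -/
@[ext] structure PlanarTree (n : ℕ) where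
  edges : Finset (ℕ × ℕ)
  inner : ∀ e ∈ edges, IsInner n e
  nonCross : ∀ e ∈ edges, ∀ e' ∈ edges, NonCross e e'

/-- Collapse an internal edge to a vertex. -/
def PlanarTree.collapse {n : ℕ} (T : PlanarTree n) (e : ℕ × ℕ) : PlanarTree n where
  edges := T.edges.erase e
  inner _ h := T.inner _ (Finset.mem_of_mem_erase h)
  nonCross _ h _ h' := T.nonCross _ (Finset.mem_of_mem_erase h) _ (Finset.mem_of_mem_erase h')

/-- Edge-labeled trees with `n` leaves; the topology is that of the disjoint union over all
trees `T` of the cubes `I ^ (internal edges of T)`. -/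
abbrev EdgeLabeledTree (n : ℕ) : Type :=
  Σ T : PlanarTree n, {e : ℕ × ℕ // e ∈ T.edges} → unitInterval

/-- An edge-labeled tree is identified with the one obtained by collapsing an edge of length `0`. -/
inductive CollapseRel {n : ℕ} : EdgeLabeledTree n → EdgeLabeledTree n → Prop
  | mk (T : PlanarTree n) (l : {e : ℕ × ℕ // e ∈ T.edges} → unitInterval)
      (e : {e : ℕ × ℕ // e ∈ T.edges}) (h : l e = 0) :
      CollapseRel ⟨T, l⟩ ⟨T.collapse e, fun e' => l ⟨e', Finset.mem_of_mem_erase e'.2⟩⟩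

/-- The associahedron `K n`: the space of metric trees with `n` leaves, with the quotient
topology. -/
def Assoc (n : ℕ) : Type := Quot (@CollapseRel n)

instance (n : ℕ) : TopologicalSpace (Assoc n) :=
  inferInstanceAs (TopologicalSpace (Quot (@CollapseRel n)))

/-- The length of the edge `e` in an edge-labeled tree, `0` if there is no such edge. -/
noncomputable def EdgeLabeledTree.len {n : ℕ} (S : EdgeLabeledTree n) (e : ℕ × ℕ) : unitInterval :=
  if h : e ∈ S.1.edges then S.2 ⟨e, h⟩ else 0

theorem EdgeLabeledTree.len_of_mem {n : ℕ} (T : PlanarTree n) (l : {e : ℕ × ℕ // e ∈ T.edges} → unitInterval)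
    {e : ℕ × ℕ} (h : e ∈ T.edges) : EdgeLabeledTree.len ⟨T, l⟩ e = l ⟨e, h⟩ := dif_pos h

theorem EdgeLabeledTree.len_of_notMem {n : ℕ} (T : PlanarTree n)
    (l : {e : ℕ × ℕ // e ∈ T.edges} → unitInterval) {e : ℕ × ℕ} (h : e ∉ T.edges) :
    EdgeLabeledTree.len ⟨T, l⟩ e = 0 := dif_neg h

namespace Assoc

/-- The length of the edge `e` in a metric tree, `0` if there is no such edge. -/
noncomputable def len {n : ℕ} : Assoc n → ℕ × ℕ → unitInterval :=
  Quot.lift EdgeLabeledTree.len (by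
    rintro _ _ ⟨T, l, e, h⟩
    funext e'
    by_cases h1 : e' = e
    · subst h1
      simp [EdgeLabeledTree.len, PlanarTree.collapse, h]
    · have h2 : e' ∈ T.edges.erase e ↔ e' ∈ T.edges := by simp [h1]
      by_cases h3 : e' ∈ T.edges
      · rw [EdgeLabeledTree.len_of_mem _ _ h3]
        exact (EdgeLabeledTree.len_of_mem (T.collapse e)
          (fun e' => l ⟨e', Finset.mem_of_mem_erase e'.2⟩) (h2.2 h3)).symm
      · rw [EdgeLabeledTree.len_of_notMem _ _ h3]
        exact (EdgeLabeledTree.len_of_notMem (T.collapse e) _ (fun h4 => h3 (h2.1 h4))).symm)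

theorem len_inner {n : ℕ} (T : Assoc n) (e : ℕ × ℕ) (h : T.len e ≠ 0) : IsInner n e := by
  induction T using Quot.ind with
  | mk S =>
    by_contra h1
    exact h (dif_neg fun h2 => h1 (S.1.inner e h2))

theorem len_nonCross {n : ℕ} (T : Assoc n) (e e' : ℕ × ℕ) (h : T.len e ≠ 0) (h' : T.len e' ≠ 0) :
    NonCross e e' := by
  induction T using Quot.ind with
  | mk S =>
    have h1 : e ∈ S.1.edges := by by_contra h2; exact h (dif_neg h2)
    have h1' : e' ∈ S.1.edges := by by_contra h2; exact h' (dif_neg h2)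
    exact S.1.nonCross e h1 e' h1'

/-- The blocks on which `L` does not vanish. -/
noncomputable def support (n : ℕ) (L : ℕ × ℕ → unitInterval) : Finset (ℕ × ℕ) :=
  @Finset.filter _ (fun e => IsInner n e ∧ L e ≠ 0) (Classical.decPred _)
    (Finset.range (n + 1) ×ˢ Finset.range (n + 1))

theorem mem_support {n : ℕ} {L : ℕ × ℕ → unitInterval} {e : ℕ × ℕ} :
    e ∈ support n L ↔ IsInner n e ∧ L e ≠ 0 := by
  unfold support
  refine (@Finset.mem_filter _ _ (Classical.decPred _) _ _).trans ?_
  refine ⟨fun h => h.2, fun h => ⟨?_, h⟩⟩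
  obtain ⟨⟨h1, h2, -⟩, -⟩ := h
  simp only [Finset.mem_product, Finset.mem_range]
  omega

/-- The metric tree whose internal edges are the blocks `e` with `L e ≠ 0`, of length `L e`. -/
noncomputable def ofLen (n : ℕ) (L : ℕ × ℕ → unitInterval)
    (hL : ∀ e e', IsInner n e → IsInner n e' → L e ≠ 0 → L e' ≠ 0 → NonCross e e') : Assoc n :=
  Quot.mk _ ⟨{
    edges := support n L
    inner := fun _ h => (mem_support.1 h).1
    nonCross := fun e h e' h' => hL e e' (mem_support.1 h).1 (mem_support.1 h').1
      (mem_support.1 h).2 (mem_support.1 h').2 }, fun e => L e⟩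

theorem ofLen_congr {n : ℕ} {L L' : ℕ × ℕ → unitInterval} (h : L = L')
    (hL : ∀ e e', IsInner n e → IsInner n e' → L e ≠ 0 → L e' ≠ 0 → NonCross e e') :
    ofLen n L hL = ofLen n L' (h ▸ hL) := by
  subst h
  rfl

theorem len_ofLen {n : ℕ} {L : ℕ × ℕ → unitInterval}
    (hL : ∀ e e', IsInner n e → IsInner n e' → L e ≠ 0 → L e' ≠ 0 → NonCross e e') (e : ℕ × ℕ) :
    (ofLen n L hL).len e = if IsInner n e then L e else 0 := by
  change EdgeLabeledTree.len _ e = _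
  unfold EdgeLabeledTree.len
  by_cases h : IsInner n e
  · by_cases h1 : L e = 0
    · simp [h1]
    · simp [mem_support, h, h1]
  · simp [mem_support, h]

theorem eqOfLen {n : ℕ} (T : PlanarTree n) (l : {e : ℕ × ℕ // e ∈ T.edges} → unitInterval)
    (S : EdgeLabeledTree n) (h : T.edges = S.1.edges)
    (hl : ∀ e : {e : ℕ × ℕ // e ∈ T.edges}, l e = S.2 ⟨e, h ▸ e.2⟩) :
    (⟨T, l⟩ : EdgeLabeledTree n) = S := by
  obtain ⟨S, k⟩ := S
  obtain rfl : T = S := PlanarTree.ext h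
  obtain rfl : l = k := funext hl
  rfl

/-- Collapsing all edges of length `0`. -/
theorem mk_eq_ofLen {n : ℕ} (S : EdgeLabeledTree n) :
    (Quot.mk _ S : Assoc n) = ofLen n S.len
      (fun e e' _ _ h h' => len_nonCross (Quot.mk _ S) e e' h h') := by
  induction hc : S.1.edges.card generalizing S with
  | zero =>
    obtain ⟨T, l⟩ := S
    have hT : T.edges = ∅ := Finset.card_eq_zero.1 hc
    refine congrArg (Quot.mk _) (eqOfLen T l _ ?_ fun e => ?_)
    · ext e
      simp [mem_support, hT, EdgeLabeledTree.len]
    · simpa [hT] using e.2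
  | succ c ih =>
    by_cases h : ∃ e, S.2 e = 0
    · obtain ⟨e, he⟩ := h
      have h0 := CollapseRel.mk S.1 S.2 e he
      have h1 := Quot.sound h0
      have h2 := congrArg len h1
      change S.len = EdgeLabeledTree.len _ at h2
      refine (h1.trans (ih _ ?_)).trans ?_
      · have : (S.1.edges.erase e).card = S.1.edges.card - 1 := Finset.card_erase_of_mem e.2
        change (S.1.edges.erase e).card = c
        omega
      · exact ofLen_congr h2.symm _
    · push Not at h
      obtain ⟨T, l⟩ := S
      refine congrArg (Quot.mk _) (eqOfLen T l _ ?_ fun e => ?_)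
      · ext e
        rw [mem_support]
        constructor
        · intro he
          refine ⟨T.inner e he, ?_⟩
          simp only [EdgeLabeledTree.len, he, dif_pos]
          exact h ⟨e, he⟩
        · rintro ⟨-, h6⟩
          by_contra h7
          exact h6 (dif_neg h7)
      · simp only [EdgeLabeledTree.len, e.2, dif_pos]

/-- A metric tree is determined by the lengths of its edges. -/
theorem ext {n : ℕ} {S T : Assoc n} (h : ∀ e, S.len e = T.len e) : S = T := by
  have h' : S.len = T.len := funext h
  induction S using Quot.ind with
  | mk S =>
    induction T using Quot.ind with
    | mk T =>
      have h2 : S.len = T.len := h'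
      exact (mk_eq_ofLen S).trans (Eq.trans (ofLen_congr h2 _) (mk_eq_ofLen T).symm)

instance (n : ℕ) : Finite (PlanarTree n) := by
  refine Finite.of_injective (β := Set (Fin (n + 1) × Fin (n + 1)))
    (fun T => {p | ((p.1 : ℕ), (p.2 : ℕ)) ∈ T.edges}) ?_
  intro S T h
  ext1
  ext e
  have key : ∀ R : PlanarTree n, e ∈ R.edges → e.1 < n + 1 ∧ e.2 < n + 1 := by
    intro R hR
    obtain ⟨h1, h2, -⟩ := R.inner e hR
    omega
  constructor
  · intro he
    obtain ⟨h1, h2⟩ := key S he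
    have := (Set.ext_iff.1 h (⟨e.1, h1⟩, ⟨e.2, h2⟩)).1 he
    exact this
  · intro he
    obtain ⟨h1, h2⟩ := key T he
    have := (Set.ext_iff.1 h (⟨e.1, h1⟩, ⟨e.2, h2⟩)).2 he
    exact this

instance (n : ℕ) : CompactSpace (Assoc n) :=
  inferInstanceAs (CompactSpace (Quot (@CollapseRel n)))

theorem continuous_len (n : ℕ) : Continuous (len : Assoc n → ℕ × ℕ → unitInterval) := by
  have h : Continuous (EdgeLabeledTree.len : EdgeLabeledTree n → ℕ × ℕ → unitInterval) := by
    rw [continuous_pi_iff]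
    intro e
    rw [continuous_sigma_iff]
    intro T
    by_cases h : e ∈ T.edges
    · simp only [EdgeLabeledTree.len_of_mem _ _ h]
      exact continuous_apply _
    · simp only [EdgeLabeledTree.len_of_notMem _ _ h]
      exact continuous_const
  exact continuous_quot_lift _ h

theorem isClosedEmbedding_len (n : ℕ) : IsClosedEmbedding (len : Assoc n → ℕ × ℕ → unitInterval) :=
  (continuous_len n).isClosedEmbedding fun _ _ h => ext fun e => congrFun h e

/-! ### Grafting -/

/-- Edge lengths after grafting a tree with `m ≥ 1` leaves (edge lengths `L'`) on the leaf `i` of a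
tree with edge lengths `L`, the new edge `(i, i + m)` having length `r`. -/
noncomputable def graftLen (m i : ℕ) (r : unitInterval) (L L' : ℕ × ℕ → unitInterval) (e : ℕ × ℕ) : unitInterval :=
  if i ≤ e.1 ∧ e.2 ≤ i + m then
    if e.1 = i ∧ e.2 = i + m then r else L' (e.1 - i, e.2 - i)
  else if e.2 ≤ i ∨ i + m ≤ e.1 ∨ (e.1 ≤ i ∧ i + m ≤ e.2) then
    L (if e.1 ≤ i then e.1 else e.1 + 1 - m, if e.2 ≤ i then e.2 else e.2 + 1 - m)
  else 0

/-- Edge lengths after erasing the leaf `i`.  The blocks which become `e` are at most two; when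
there are two of them, they are the edges adjacent to the erased vertex. -/
noncomputable def degenLen (i : ℕ) (L : ℕ × ℕ → unitInterval) (e : ℕ × ℕ) : unitInterval :=
  max (L (if e.1 ≤ i then e.1 else e.1 + 1, if e.2 < i then e.2 else e.2 + 1))
    (L (if e.1 < i then e.1 else e.1 + 1, if e.2 ≤ i then e.2 else e.2 + 1))

theorem graftLen_nonCross {n m : ℕ} (i : ℕ) (r : unitInterval) (ρ : Assoc n) (τ : Assoc m)
    (e e' : ℕ × ℕ) (hs : e.1 + 2 ≤ e.2) (hs' : e'.1 + 2 ≤ e'.2)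
    (h : graftLen m i r ρ.len τ.len e ≠ 0)
    (h' : graftLen m i r ρ.len τ.len e' ≠ 0) : NonCross e e' := by
  obtain ⟨a, b⟩ := e
  obtain ⟨a', b'⟩ := e'
  have hρ := len_nonCross ρ
  have hτ := len_nonCross τ
  unfold NonCross at hρ hτ ⊢
  unfold graftLen at h h'
  dsimp only at *
  have hi := len_inner ρ
  unfold IsInner at hi
  split_ifs at h h' <;>
    first
    | omega
    | (have := hρ _ _ h h'; dsimp only at this; omega)
    | (have := hτ _ _ h h'; dsimp only at this; omega)
    | exact absurd rfl h
    | exact absurd rfl h'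

theorem degenLen_nonCross {n : ℕ} (i : ℕ) (ρ : Assoc n) (e e' : ℕ × ℕ)
    (hs : e.1 + 2 ≤ e.2) (hs' : e'.1 + 2 ≤ e'.2) (h : degenLen i ρ.len e ≠ 0)
    (h' : degenLen i ρ.len e' ≠ 0) : NonCross e e' := by
  obtain ⟨a, b⟩ := e
  obtain ⟨a', b'⟩ := e'
  have key : ∀ x y : unitInterval, max x y ≠ 0 → x ≠ 0 ∨ y ≠ 0 := by
    intro x y hxy
    by_contra hc
    push Not at hc
    simp [hc.1, hc.2] at hxy
  have hρ := len_nonCross ρ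
  unfold NonCross at hρ ⊢
  unfold degenLen at h h'
  dsimp only at *
  rcases key _ _ h with h | h <;> rcases key _ _ h' with h' | h' <;>
    (have := hρ _ _ h h'; dsimp only at this; split_ifs at this <;> omega)

/-- Grafting `τ` on the leaf `i` of `ρ`, the new edge having length `r`.  If `n = 1` or `m = 1`
there is no new internal edge, and for `m = 0` the leaf `i` is erased.  The number `N = n + m - 1`
of leaves of the result is given by the proof `h`. -/
noncomputable def graft {n m N : ℕ} (_h : N + 1 = n + m) (r : unitInterval) (i : Fin n) (ρ : Assoc n)
    (τ : Assoc m) : Assoc N :=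
  if m = 0 then
    ofLen N (degenLen i ρ.len)
      (fun e e' he he' => degenLen_nonCross i ρ e e' he.1 he'.1)
  else
    ofLen N (graftLen m i r ρ.len τ.len)
      (fun e e' he he' => graftLen_nonCross i r ρ τ e e' he.1 he'.1)

theorem len_graft {n m N : ℕ} (h : N + 1 = n + m) (r : unitInterval) (i : Fin n) (ρ : Assoc n)
    (τ : Assoc m) (e : ℕ × ℕ) : (graft h r i ρ τ).len e = if IsInner N e then
      if m = 0 then degenLen i ρ.len e else graftLen m i r ρ.len τ.len e else 0 := by
  unfold graft
  by_cases hm : m = 0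
  · rw [if_pos hm, len_ofLen, if_pos hm]
  · rw [if_neg hm, len_ofLen, if_neg hm]

/-- The corolla `δ n`: the tree with `n` leaves and no internal edge. -/
noncomputable def corolla (n : ℕ) : Assoc n := ofLen n (fun _ => 0) (by simp)

/-- The deshift of a tree: the orientation of all edges joining the first leaf to the root is
reversed, so that the first leaf becomes the root and the root becomes the last leaf.
An edge `(a + 1, b + 1)` becomes `(a, b)`, and an edge `(0, a + 1)` becomes `(a, n)`. -/
noncomputable def deshift {n : ℕ} (T : Assoc n) : Assoc n :=
  ofLen n (fun e => if e.2 < n then T.len (e.1 + 1, e.2 + 1) else T.len (0, e.1 + 1)) (by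
    rintro ⟨a, b⟩ ⟨a', b'⟩ he he' h h'
    have hT := len_nonCross T
    unfold NonCross at hT ⊢
    unfold IsInner at he he'
    dsimp only at *
    split_ifs at h h' <;> (have := hT _ _ h h'; dsimp only at this; omega))

/-- The length `2 (1 + ∑ u)` of a tree with at least two leaves, where the sum is over the lengths
`u` of the internal edges of the path joining the first leaf to the root. -/
noncomputable def length {n : ℕ} (T : Assoc n) : ℝ≥0 :=
  2 * (1 + ∑ b ∈ Finset.range (n + 1), Real.toNNReal (T.len (0, b)))

end Assoc

/-! ### Compactly generated topologies and `A∞`-spaces -/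

/-- Continuity of `f` for the compactly generated topology on `Z`, the one of the category of
compactly generated spaces when `Z` is a product of spaces. -/
def KContinuous {Z : Type u} {W : Type v} [TopologicalSpace Z] [tW : TopologicalSpace W]
    (f : Z → W) : Prop :=
  Continuous[TopologicalSpace.compactlyGenerated.{u} Z, tW] f

theorem compactlyGenerated_le {Z : Type u} [t : TopologicalSpace Z] :
    TopologicalSpace.compactlyGenerated.{u} Z ≤ t := by
  rw [← continuous_id_iff_le]
  exact continuous_from_compactlyGenerated _ fun _ g => g.continuous

/-- Maps from a compact Hausdorff space which are continuous stay continuous for the compactly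
generated topology on the target. -/
theorem continuous_to_compactlyGenerated {S : CompHaus.{u}} {Z : Type u} [t : TopologicalSpace Z]
    {f : S → Z} (hf : Continuous f) :
    Continuous[_, TopologicalSpace.compactlyGenerated.{u} Z] f := by
  let k : (Σ (i : (S : CompHaus.{u}) × C(S, Z)), i.fst) → Z := fun x => x.1.2 x.2
  have h : Continuous[_, TopologicalSpace.compactlyGenerated.{u} Z] k := continuous_coinduced_rng
  have h' : Continuous (fun y : S => (⟨⟨S, ⟨f, hf⟩⟩, y⟩ :
      (Σ (i : (S : CompHaus.{u}) × C(S, Z)), i.fst))) :=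
    continuous_sigmaMk (σ := fun i : (S : CompHaus.{u}) × C(S, Z) => i.fst) (i := ⟨S, ⟨f, hf⟩⟩)
  have h1 := @Continuous.comp _ _ _ _ _ (TopologicalSpace.compactlyGenerated.{u} Z) _ _ h h'
  exact h1

/-- The tuple `(x_0, …, x_{i-1}, g (x_i, …, x_{i+m-1}), x_{i+m}, …, x_{N-1})` of length `n`. -/
def plug {X : Type u} {n m N : ℕ} (h : N + 1 = n + m) (i : Fin n) (g : (Fin m → X) → X)
    (x : Fin N → X) (j : Fin n) : X :=
  if hj : (j : ℕ) < i then x ⟨j, by omega⟩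
  else if hj' : (j : ℕ) = i then g (fun l => x ⟨i + l, by omega⟩)
  else x ⟨j + m - 1, by omega⟩

/-- Strictly unital `A∞`-spaces: algebras over the operad of associahedra `K n`, `n ≥ 0`.
The strict unit is the value of `M 0`. -/
class AInfinitySpace (X : Type u) [TopologicalSpace X] where
  M : ∀ n : ℕ, Assoc n → (Fin n → X) → X
  continuous_M : ∀ n, KContinuous (fun p : Assoc n × (Fin n → X) => M n p.1 p.2)
  M_one : ∀ x : Fin 1 → X, M 1 (Assoc.corolla 1) x = x 0
  M_graft : ∀ {n m N : ℕ} (h : N + 1 = n + m) (i : Fin n) (ρ : Assoc n) (τ : Assoc m)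
    (x : Fin N → X), M N (Assoc.graft h 1 i ρ τ) x = M n ρ (plug h i (M m τ) x)

/-- Topological monoids, in the category of compactly generated spaces. -/
class KMonoid (Y : Type u) [TopologicalSpace Y] extends Monoid Y where
  continuous_mul' : KContinuous (fun p : Y × Y => p.1 * p.2)

/-- The maps `F n`, `n ≥ 1`, exhibit `f` as an `A∞`-map from an `A∞`-space to a topological
monoid.  (The value of `F 0` plays no role.) -/
structure IsAInfinityFamily {X : Type u} [TopologicalSpace X] [AInfinitySpace X]
    {Y : Type v} [TopologicalSpace Y] [KMonoid Y] (f : X → Y)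
    (F : ∀ n : ℕ, Assoc (n + 1) → (Fin n → X) → Y) : Prop where
  continuous : ∀ n, 1 ≤ n → KContinuous (fun p : Assoc (n + 1) × (Fin n → X) => F n p.1 p.2)
  apply_one : ∀ x : X, f x = F 1 (Assoc.corolla 2) (fun _ => x)
  graft_succ : ∀ {p m k : ℕ} (h : k + 1 = p + m) (_ : 1 ≤ p) (_ : 2 ≤ m) (j : Fin p)
    (ρ : Assoc (p + 1)) (τ : Assoc m) (x : Fin k → X),
    F k (Assoc.graft (by omega) 1 j.succ ρ τ) x = F p ρ (plug h j (AInfinitySpace.M m τ) x)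
  graft_zero : ∀ {p q : ℕ} (_ : 1 ≤ p) (_ : 1 ≤ q) (ρ : Assoc (p + 1)) (τ : Assoc (q + 1))
    (x : Fin (q + p) → X),
    F (q + p) (Assoc.graft (by omega) 1 0 ρ τ) x =
      F q τ (fun l => x (Fin.castAdd p l)) * F p ρ (fun l => x (Fin.natAdd q l))

/-- `f` is an `A∞`-map. -/
def IsAInfinityMap {X : Type u} [TopologicalSpace X] [AInfinitySpace X]
    {Y : Type v} [TopologicalSpace Y] [KMonoid Y] (f : X → Y) : Prop :=
  ∃ F : ∀ n : ℕ, Assoc (n + 1) → (Fin n → X) → Y, IsAInfinityFamily f F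

/-! ### Moore loops -/

/-- Moore loops on `B` based at `b`. -/
@[ext] structure MooreLoop (B : Type u) [TopologicalSpace B] (b : B) where
  path : C(ℝ≥0, B)
  length : ℝ≥0
  stationary : ∀ t, length ≤ t → path t = path length
  source : path 0 = b
  target : path length = b

namespace MooreLoop

variable {B : Type u} [TopologicalSpace B] {b : B}

/-- The topology of `C(ℝ≥0, B) × ℝ≥0` restricted to Moore loops, before passing to the associated
compactly generated topology. -/
@[reducible] def preTopology (b : B) : TopologicalSpace (MooreLoop B b) :=
  TopologicalSpace.induced (fun γ => (γ.path, γ.length)) inferInstance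

instance : TopologicalSpace (MooreLoop B b) :=
  @TopologicalSpace.compactlyGenerated.{u} _ (preTopology b)

theorem path_of_le (γ : MooreLoop B b) {t : ℝ≥0} (h : γ.length ≤ t) : γ.path t = b :=
  (γ.stationary t h).trans γ.target

theorem juxtapose_end (γ₁ γ₂ : MooreLoop B b) (t : ℝ≥0) (ht : γ₁.length + γ₂.length ≤ t) :
    (if t ≤ γ₁.length then γ₁.path t else γ₂.path (t - γ₁.length)) = b := by
  split_ifs with h
  · rw [le_antisymm h (le_self_add.trans ht), γ₁.target]
  · exact γ₂.path_of_le (le_tsub_of_add_le_left ht)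

/-- Juxtaposition of loops. -/
noncomputable instance : Mul (MooreLoop B b) where
  mul γ₁ γ₂ :=
    { path := ⟨fun t => if t ≤ γ₁.length then γ₁.path t else γ₂.path (t - γ₁.length), by
        refine Continuous.if_le (by fun_prop) (by fun_prop) (by fun_prop) (by fun_prop) ?_
        intro t ht
        simp [ht, γ₁.target, γ₂.source]⟩
      length := γ₁.length + γ₂.length
      stationary := fun t ht => (juxtapose_end γ₁ γ₂ t ht).trans (juxtapose_end γ₁ γ₂ _ le_rfl).symm
      source := by simp [γ₁.source]
      target := juxtapose_end γ₁ γ₂ _ le_rfl }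

theorem mul_path (γ₁ γ₂ : MooreLoop B b) (t : ℝ≥0) : (γ₁ * γ₂).path t =
    if t ≤ γ₁.length then γ₁.path t else γ₂.path (t - γ₁.length) := rfl

theorem mul_length (γ₁ γ₂ : MooreLoop B b) : (γ₁ * γ₂).length = γ₁.length + γ₂.length := rfl

instance : One (MooreLoop B b) where
  one := ⟨ContinuousMap.const _ b, 0, fun _ _ => rfl, rfl, rfl⟩

theorem one_path (t : ℝ≥0) : (1 : MooreLoop B b).path t = b := rfl

theorem one_length : (1 : MooreLoop B b).length = 0 := rfl

theorem ext' {γ₁ γ₂ : MooreLoop B b} (h : ∀ t, γ₁.path t = γ₂.path t)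
    (hl : γ₁.length = γ₂.length) : γ₁ = γ₂ :=
  MooreLoop.ext (ContinuousMap.ext h) hl

noncomputable instance : Monoid (MooreLoop B b) where
  mul_assoc γ₁ γ₂ γ₃ := by
    refine ext' (fun t => ?_) (add_assoc _ _ _)
    simp only [mul_path, mul_length]
    by_cases h1 : t ≤ γ₁.length
    · have h2 : t ≤ γ₁.length + γ₂.length := h1.trans le_self_add
      simp [h1, h2]
    · have h2 : t ≤ γ₁.length + γ₂.length ↔ t - γ₁.length ≤ γ₂.length :=
        tsub_le_iff_left.symm
      simp [h1, h2, tsub_add_eq_tsub_tsub]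
  one_mul γ := by
    refine ext' (fun t => ?_) (zero_add _)
    simp only [mul_path, one_length, one_path]
    split_ifs with h
    · rw [le_antisymm h bot_le, γ.source]
    · simp
  mul_one γ := by
    refine ext' (fun t => ?_) (add_zero _)
    simp only [mul_path, one_path]
    split_ifs with h
    · rfl
    · exact (γ.path_of_le (le_of_not_ge h)).symm

theorem continuous_mul_pre : @Continuous _ _
    (@instTopologicalSpaceProd _ _ (preTopology b) (preTopology b)) (preTopology b)
    (fun p : MooreLoop B b × MooreLoop B b => p.1 * p.2) := by
  let _ : TopologicalSpace (MooreLoop B b) := preTopology b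
  have hi : Continuous (fun γ : MooreLoop B b => (γ.path, γ.length)) := continuous_induced_dom
  have hp : Continuous (fun γ : MooreLoop B b => γ.path) := continuous_fst.comp hi
  have hl : Continuous (fun γ : MooreLoop B b => γ.length) := continuous_snd.comp hi
  refine continuous_induced_rng.2 (Continuous.prodMk ?_ ?_)
  · refine ContinuousMap.continuous_of_continuous_uncurry _ ?_
    change Continuous (fun q : (MooreLoop B b × MooreLoop B b) × ℝ≥0 =>
      if q.2 ≤ q.1.1.length then q.1.1.path q.2 else q.1.2.path (q.2 - q.1.1.length))
    have h1 : Continuous (fun q : (MooreLoop B b × MooreLoop B b) × ℝ≥0 => q.1.1.length) :=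
      hl.comp (continuous_fst.comp continuous_fst)
    refine Continuous.if_le ?_ ?_ continuous_snd h1 ?_
    · exact ContinuousEval.continuous_eval.comp
        ((hp.comp (continuous_fst.comp continuous_fst)).prodMk continuous_snd)
    · exact ContinuousEval.continuous_eval.comp
        ((hp.comp (continuous_snd.comp continuous_fst)).prodMk (continuous_snd.sub h1))
    · rintro ⟨⟨γ₁, γ₂⟩, t⟩ ht
      dsimp only at ht
      simp [ht, γ₁.target, γ₂.source]
  · exact (hl.comp continuous_fst).add (hl.comp continuous_snd)

noncomputable instance : KMonoid (MooreLoop B b) where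
  continuous_mul' := by
    unfold KContinuous
    refine continuous_from_compactlyGenerated _ fun S g => ?_
    have hle : (inferInstance : TopologicalSpace (MooreLoop B b)) ≤ preTopology b :=
      @compactlyGenerated_le _ (preTopology b)
    have h1 : @Continuous _ _ _ (preTopology b) (fun s : S => (g s).1) :=
      continuous_le_rng hle (continuous_fst.comp g.continuous)
    have h2 : @Continuous _ _ _ (preTopology b) (fun s : S => (g s).2) :=
      continuous_le_rng hle (continuous_snd.comp g.continuous)
    refine continuous_to_compactlyGenerated (t := preTopology b) ?_
    exact @Continuous.comp _ _ _ _
      (@instTopologicalSpaceProd _ _ (preTopology b) (preTopology b)) (preTopology b) _ _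
      continuous_mul_pre (@Continuous.prodMk _ _ _ (preTopology b) (preTopology b) _ _ _ h1 h2)

end MooreLoop

/-! ### The classifying space -/

/-- The disjoint union of the spaces `K (n + 2) × * × X ^ n × *`. -/
def BarPre (X : Type u) : Type u := Σ n : ℕ, Assoc (n + 2) × (Fin n → X)

instance (X : Type u) [TopologicalSpace X] : TopologicalSpace (BarPre X) :=
  @instTopologicalSpaceSigma ℕ (fun n => Assoc (n + 2) × (Fin n → X))
    (fun n => TopologicalSpace.compactlyGenerated.{u} (Assoc (n + 2) × (Fin n → X)))

/-- The identifications of the bar construction `B(*, X, *)`, in `K (n + 2) × * × X ^ n × *`.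
If the tree is `ρ ∘ τ` then `τ` acts on its inputs: trivially if they contain the first or the
last point `*`, by the structure map of `X` otherwise. -/
inductive BarRel {X : Type u} [TopologicalSpace X] [AInfinitySpace X] : BarPre X → BarPre X → Prop
  | left {p m N : ℕ} (h : N + 1 = p + m) (hm : 1 ≤ m) (ρ : Assoc (p + 2)) (τ : Assoc m)
      (x : Fin N → X) :
      BarRel ⟨N, Assoc.graft (by omega) 1 0 ρ τ, x⟩ ⟨p, ρ, fun j => x ⟨j + m - 1, by omega⟩⟩
  | middle {p m N : ℕ} (h : N + 1 = p + m) (hm : 1 ≤ m) (i : Fin p) (ρ : Assoc (p + 2))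
      (τ : Assoc m) (x : Fin N → X) :
      BarRel ⟨N, Assoc.graft (by omega) 1 i.succ.castSucc ρ τ, x⟩
        ⟨p, ρ, plug h i (AInfinitySpace.M m τ) x⟩
  | right {p m N : ℕ} (h : N + 1 = p + m) (hm : 1 ≤ m) (ρ : Assoc (p + 2)) (τ : Assoc m)
      (x : Fin N → X) :
      BarRel ⟨N, Assoc.graft (by omega) 1 (Fin.last (p + 1)) ρ τ, x⟩
        ⟨p, ρ, fun j => x ⟨j, by omega⟩⟩

/-- The classifying space `BX = B(*, X, *)`. -/
def ClassifyingSpace (X : Type u) [TopologicalSpace X] [AInfinitySpace X] : Type u :=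
  Quot (@BarRel X _ _)

namespace ClassifyingSpace

variable {X : Type u} [TopologicalSpace X] [AInfinitySpace X]

instance : TopologicalSpace (ClassifyingSpace X) :=
  inferInstanceAs (TopologicalSpace (Quot (@BarRel X _ _)))

/-- The class `[T; *, x, *]`. -/
def mk {n : ℕ} (T : Assoc (n + 2)) (x : Fin n → X) : ClassifyingSpace X :=
  Quot.mk _ (⟨n, T, x⟩ : BarPre X)

/-- The base point `[δ 2; *, *]`. -/
noncomputable def base (X : Type u) [TopologicalSpace X] [AInfinitySpace X] : ClassifyingSpace X :=
  mk (Assoc.corolla 2) (Fin.elim0 : Fin 0 → X)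

end ClassifyingSpace

/-- A real number in `[0, 1]` as an edge length. -/
noncomputable def edgeLength (t : ℝ) : unitInterval := Set.projIcc 0 1 zero_le_one t

/-- The sliding path of the tree `δ 2`: in `K 3`, from `δ 2 ∘ δ 2` (grafting on the last leaf)
to `δ 2 ∘ δ 2` (grafting on the first leaf). -/
noncomputable def slideTwo (t : ℝ≥0) : Assoc 3 :=
  if (t : ℝ) ≤ 1 then
    Assoc.graft (n := 2) (m := 2) rfl (edgeLength (1 - t)) 1 (Assoc.corolla 2) (Assoc.corolla 2)
  else Assoc.graft (n := 2) (m := 2) rfl (edgeLength (t - 1)) 0 (Assoc.corolla 2) (Assoc.corolla 2)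

theorem continuous_graft_corolla (i : Fin 2) : Continuous (fun r : unitInterval =>
    (Assoc.graft (n := 2) (m := 2) rfl r i (Assoc.corolla 2) (Assoc.corolla 2) : Assoc 3)) := by
  rw [(Assoc.isClosedEmbedding_len 3).isInducing.continuous_iff, continuous_pi_iff]
  intro e
  simp only [Function.comp_def, Assoc.len_graft, Assoc.graftLen]
  split_ifs <;> fun_prop

theorem len_corolla (n : ℕ) (e : ℕ × ℕ) : (Assoc.corolla n).len e = 0 := by
  simp [Assoc.corolla, Assoc.len_ofLen]

theorem graft_corolla_zero (i : Fin 2) :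
    (Assoc.graft (n := 2) (m := 2) rfl 0 i (Assoc.corolla 2) (Assoc.corolla 2) : Assoc 3) = Assoc.corolla 3 := by
  refine Assoc.ext fun e => ?_
  simp [Assoc.len_graft, Assoc.graftLen, len_corolla]

theorem continuous_slideTwo : Continuous slideTwo := by
  have hs : Continuous edgeLength := continuous_projIcc (h := zero_le_one)
  unfold slideTwo
  refine Continuous.if_le ((continuous_graft_corolla 1).comp (hs.comp (by fun_prop)))
    ((continuous_graft_corolla 0).comp (hs.comp (by fun_prop))) (by fun_prop) (by fun_prop) ?_
  intro t ht
  have h0 : edgeLength 0 = 0 := by simp [edgeLength]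
  rw [ht, sub_self, h0]
  exact (graft_corolla_zero 1).trans (graft_corolla_zero 0).symm

theorem slideTwo_of_two_le (t : ℝ≥0) (ht : 2 ≤ t) :
    slideTwo t = Assoc.graft (n := 2) (m := 2) rfl 1 0 (Assoc.corolla 2) (Assoc.corolla 2) := by
  have ht' : (2 : ℝ) ≤ t := by exact_mod_cast ht
  have h1 : edgeLength (t - 1) = 1 := Set.projIcc_of_right_le _ (by linarith)
  rw [slideTwo, if_neg (by linarith), h1]

theorem slideTwo_zero :
    slideTwo 0 = Assoc.graft (n := 2) (m := 2) rfl 1 1 (Assoc.corolla 2) (Assoc.corolla 2) := by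
  have h1 : edgeLength (1 - ((0 : ℝ≥0) : ℝ)) = 1 := Set.projIcc_of_right_le _ (by simp)
  rw [slideTwo, if_pos (by simp), h1]

theorem ClassifyingSpace.continuous_mk_slideTwo {X : Type u} [TopologicalSpace X]
    [AInfinitySpace X] (x : X) :
    Continuous (fun t => ClassifyingSpace.mk (slideTwo t) (fun _ : Fin 1 => x)) := by
  refine continuous_from_uCompactlyGeneratedSpace.{u} _ fun S g => ?_
  have h : Continuous[_, TopologicalSpace.compactlyGenerated.{u} _]
      (fun y : S => ((slideTwo (g y), fun _ : Fin 1 => x) : Assoc 3 × (Fin 1 → X))) :=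
    continuous_to_compactlyGenerated
      ((continuous_slideTwo.comp g.continuous).prodMk continuous_const)
  have h2 := @Continuous.comp S (Assoc 3 × (Fin 1 → X)) (BarPre X) _
    (TopologicalSpace.compactlyGenerated.{u} _) inferInstance _ _
    (@continuous_sigmaMk ℕ (fun n => Assoc (n + 2) × (Fin n → X))
      (fun n => TopologicalSpace.compactlyGenerated.{u} (Assoc (n + 2) × (Fin n → X))) 1) h
  have h3 : Continuous (fun p : BarPre X => (Quot.mk _ p : ClassifyingSpace X)) :=
    continuous_quot_mk
  exact h3.comp h2

/-- The usual map `X → Ω BX`, whose values are loops of length `2`. -/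
noncomputable def usualMap (X : Type u) [TopologicalSpace X] [AInfinitySpace X] (x : X) :
    MooreLoop (ClassifyingSpace X) (ClassifyingSpace.base X) where
  path := ⟨fun t => ClassifyingSpace.mk (slideTwo t) (fun _ : Fin 1 => x),
    ClassifyingSpace.continuous_mk_slideTwo x⟩
  length := 2
  stationary t ht := by
    change ClassifyingSpace.mk (slideTwo t) _ = ClassifyingSpace.mk (slideTwo 2) _
    rw [slideTwo_of_two_le t ht, slideTwo_of_two_le 2 le_rfl]
  source := by
    change ClassifyingSpace.mk (slideTwo 0) _ = _
    rw [slideTwo_zero]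
    refine (Quot.sound (BarRel.right (p := 0) (m := 2) (N := 1) rfl (by omega)
      (Assoc.corolla 2) (Assoc.corolla 2) (fun _ => x))).trans ?_
    exact congrArg (ClassifyingSpace.mk (Assoc.corolla 2)) (Subsingleton.elim _ _)
  target := by
    change ClassifyingSpace.mk (slideTwo 2) _ = _
    rw [slideTwo_of_two_le 2 le_rfl]
    refine (Quot.sound (BarRel.left (p := 0) (m := 2) (N := 1) rfl (by omega)
      (Assoc.corolla 2) (Assoc.corolla 2) (fun _ => x))).trans ?_
    exact congrArg (ClassifyingSpace.mk (Assoc.corolla 2)) (Subsingleton.elim _ _)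

/-! ### Sliding paths in the associahedra -/

/-- A coherent family of paths: for `n ≥ 2` and `T` in `K n`, `σ n T` is a Moore path in `K (n + 1)`
of length `T.length`, from `δ 2 ∘ T` (the deshift of `T` being grafted on the last leaf) to
`δ 2 ∘ T` (grafting on the first leaf), compatible with grafting. -/
structure IsSlidingFamily (σ : ∀ n : ℕ, Assoc n → ℝ≥0 → Assoc (n + 1)) : Prop where
  continuous : ∀ n, 2 ≤ n → Continuous (fun p : Assoc n × ℝ≥0 => σ n p.1 p.2)
  stationary : ∀ n, 2 ≤ n → ∀ (T : Assoc n) (t : ℝ≥0), T.length ≤ t → σ n T t = σ n T T.length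
  source : ∀ n, 2 ≤ n → ∀ T : Assoc n,
    σ n T 0 = Assoc.graft (by omega) 1 1 (Assoc.corolla 2) T.deshift
  target : ∀ n, 2 ≤ n → ∀ T : Assoc n,
    σ n T T.length = Assoc.graft (by omega) 1 0 (Assoc.corolla 2) T
  graft_of_pos : ∀ {n m N : ℕ} (h : N + 1 = n + m) (_ : 2 ≤ n) (_ : 2 ≤ m) (i : Fin n)
    (_ : 0 < (i : ℕ)) (T₁ : Assoc n) (T₂ : Assoc m) (t : ℝ≥0),
    σ N (Assoc.graft h 1 i T₁ T₂) t = Assoc.graft (by omega) 1 i.castSucc (σ n T₁ t) T₂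
  graft_zero : ∀ {n m N : ℕ} (h : N + 1 = n + m) (hn : 2 ≤ n) (_ : 2 ≤ m)
    (T₁ : Assoc n) (T₂ : Assoc m) (t : ℝ≥0),
    σ N (Assoc.graft h 1 ⟨0, by omega⟩ T₁ T₂) t =
      if t ≤ T₂.length then Assoc.graft (by omega) 1 (Fin.last m) (σ m T₂ t) T₁.deshift
      else Assoc.graft (by omega) 1 0 (σ n T₁ (t - T₂.length)) T₂
  two : ∀ t, σ 2 (Assoc.corolla 2) t = slideTwo t

/-!
A point of `K (n + 1)` on the sliding path of a tree `T` with `n` leaves is `T` with its old root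
turned into the last leaf and a new root attached somewhere on the left spine, the path joining the
first leaf to the old root.  The path `slide n T` moves the new root along the spine, from the edge
of the first leaf to the edge of the old root.  When the new root cuts an edge of length `u` in two,
at least one of the two parts has length `u`: first the part behind the root grows from `0` to `u`,
then the part ahead of it shrinks from `u` to `0`.  This takes time `2 u`.  The two external edges
of the spine count as edges of length `1`, of which only half is travelled, hence the
length `2 (1 + ∑ u)`.

In terms of blocks of leaves, an edge `(0, b)` of the spine has the complementary block
`(b, n + 1)` until the new root reaches it, and the block `(0, b)` after the new root has passed.
With `spineSum T b` the total
weight of the spine above `(0, b)`, both lengths are truncated affine functions of the time (see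
`slideLen`), so that the continuity of `slide` is clear.  At each time the edges form a tree
(`slideLen_nonCross`) because `spineSum T` is monotone.

Grafting on a leaf other than the first one does not affect the spine except for a renumbering
(`slide_graft_of_pos`).  Grafting on the first leaf concatenates the two spines, the last edge of
the upper one and the first edge of the lower one being merged to an edge of length `1`
(`spineSum_graft_zero_of_ge`); when the new root is at the middle of this edge both of its parts
have length `1`, which splits the sliding path as a juxtaposition (`slide_graft_zero_of_le` and
`slide_graft_zero_of_lt`).

In the classifying space a tree grafted on the first or the last leaf is forgotten, and a tree
grafted on another leaf acts on its inputs.  The ends of the sliding paths therefore become the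
base point, and the two grafting rules become the two relations of an `A∞`-map
(`isAInfinityFamily_slideFamily`).  Continuity holds since the quotient map to the classifying
space may be tested on compact Hausdorff spaces (`continuous_mk_comp`).
-/

/-! ### Edge lengths -/

theorem edgeLength_of_nonpos {r : ℝ} (h : r ≤ 0) : edgeLength r = 0 :=
  projIcc_of_le_left _ h

theorem edgeLength_of_one_le {r : ℝ} (h : 1 ≤ r) : edgeLength r = 1 :=
  projIcc_of_right_le _ h

theorem edgeLength_coe (r : unitInterval) : edgeLength (r : ℝ) = r :=
  projIcc_val _ r

theorem continuous_edgeLength : Continuous edgeLength :=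
  continuous_projIcc (h := zero_le_one)

theorem pos_of_edgeLength_ne_zero {r : ℝ} (h : edgeLength r ≠ 0) : 0 < r :=
  not_le.1 fun h' => h (edgeLength_of_nonpos h')

namespace Assoc

theorem len_of_not_inner {n : ℕ} (T : Assoc n) {e : ℕ × ℕ} (h : ¬ IsInner n e) : T.len e = 0 :=
  not_not.1 fun h' => h (T.len_inner e h')

/-! ### The left spine -/

/-- The lengths of the edges `(0, b)` on the path from the first leaf to the root.  The two
external edges of the path, the one above the first leaf (`b = 1`) and the one below the root
vertex (`b = n`), are given the length `1`.  If `n ≠ 0`, the value at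
`b = 0` and at `b > n` is `0`. -/
noncomputable def spineWeight {n : ℕ} (T : Assoc n) (b : ℕ) : ℝ :=
  if b = 1 ∨ b = n then 1 else T.len (0, b)

/-- The total weight of the edges of the left spine which lie above the edge `(0, b)`. -/
noncomputable def spineSum {n : ℕ} (T : Assoc n) (b : ℕ) : ℝ :=
  ∑ c ∈ Finset.range b, T.spineWeight c

variable {n m N : ℕ}

theorem spineWeight_nonneg (T : Assoc n) (b : ℕ) : 0 ≤ T.spineWeight b := by
  unfold spineWeight
  split_ifs
  · exact zero_le_one
  · exact (T.len (0, b)).2.1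

theorem spineWeight_le_one (T : Assoc n) (b : ℕ) : T.spineWeight b ≤ 1 := by
  unfold spineWeight
  split_ifs
  · exact le_rfl
  · exact (T.len (0, b)).2.2

theorem spineWeight_one (T : Assoc n) : T.spineWeight 1 = 1 := if_pos (Or.inl rfl)

theorem spineWeight_last (T : Assoc n) : T.spineWeight n = 1 := if_pos (Or.inr rfl)

theorem spineWeight_of_ne (T : Assoc n) {b : ℕ} (h1 : b ≠ 1) (hn : b ≠ n) :
    T.spineWeight b = T.len (0, b) := if_neg (by tauto)

theorem spineWeight_zero (T : Assoc n) (hn : n ≠ 0) : T.spineWeight 0 = 0 := by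
  rw [spineWeight_of_ne T zero_ne_one hn.symm, len_of_not_inner T (by simp [IsInner])]
  rfl

theorem spineSum_succ (T : Assoc n) (b : ℕ) :
    T.spineSum (b + 1) = T.spineSum b + T.spineWeight b := Finset.sum_range_succ _ _

theorem spineSum_mono (T : Assoc n) : Monotone T.spineSum :=
  monotone_nat_of_le_succ fun b => by
    rw [spineSum_succ]
    exact le_add_of_nonneg_right (T.spineWeight_nonneg b)

theorem spineSum_zero (T : Assoc n) : T.spineSum 0 = 0 := Finset.sum_range_zero _

theorem spineSum_one (T : Assoc n) (hn : n ≠ 0) : T.spineSum 1 = 0 := by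
  rw [spineSum_succ, spineSum_zero, spineWeight_zero T hn, add_zero]

theorem spineSum_two (T : Assoc n) (hn : n ≠ 0) : T.spineSum 2 = 1 := by
  rw [spineSum_succ, spineSum_one T hn, spineWeight_one, zero_add]

theorem one_le_spineSum (T : Assoc n) (hn : n ≠ 0) {b : ℕ} (hb : 2 ≤ b) : 1 ≤ T.spineSum b :=
  (T.spineSum_two hn).symm.le.trans (T.spineSum_mono hb)

theorem continuous_spineWeight (b : ℕ) : Continuous fun T : Assoc n => T.spineWeight b := by
  unfold spineWeight
  split_ifs
  · exact continuous_const
  · exact continuous_subtype_val.comp ((continuous_apply _).comp (continuous_len n))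

theorem continuous_spineSum (b : ℕ) : Continuous fun T : Assoc n => T.spineSum b :=
  continuous_finsetSum _ fun c _ => continuous_spineWeight c

theorem length_eq_spineSum (T : Assoc n) (hn : 2 ≤ n) : (T.length : ℝ) = 2 * T.spineSum n := by
  have h : ∀ b ∈ Finset.range n,
      T.spineWeight b = (T.len (0, b) : ℝ) + if b = 1 then 1 else 0 := by
    intro b hb
    rw [Finset.mem_range] at hb
    by_cases h1 : b = 1
    · subst h1
      rw [spineWeight_one, len_of_not_inner T (by simp [IsInner])]
      simp
    · rw [spineWeight_of_ne T h1 hb.ne, if_neg h1, add_zero]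
  unfold length spineSum
  rw [Finset.sum_congr rfl h, Finset.sum_add_distrib, Finset.sum_ite_eq',
    if_pos (Finset.mem_range.2 hn), Finset.sum_range_succ,
    len_of_not_inner T (e := (0, n)) (by simp [IsInner])]
  have h0 : ∀ e, 0 ≤ (T.len e : ℝ) := fun e => (T.len e).2.1
  push_cast
  simp only [Real.coe_toNNReal', h0, sup_of_le_left]
  simp
  ring

theorem continuous_length (hn : 2 ≤ n) : Continuous (length : Assoc n → ℝ≥0) := by
  refine continuous_induced_rng.2 ?_
  exact (continuous_const.mul (continuous_spineSum n)).congr fun T =>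
    (length_eq_spineSum T hn).symm

/-! ### Sliding the root along the left spine -/

/-- The edge lengths at time `t` of the tree with `n + 1` leaves obtained from `T` by turning the
root into the last leaf and attaching a new root to the path from the first leaf to the old root.

The new root starts at the middle of the edge of the first leaf.  It crosses an edge of length `u`
in time `2 u`: for a time `u` the part `(0, b)` of the edge behind the root grows from `0` to `u`,
and then for a time `u` the part `(b, n + 1)` ahead of it shrinks from `u` to `0`. -/
noncomputable def slideLen (T : Assoc n) (t : ℝ≥0) (e : ℕ × ℕ) : unitInterval :=
  if e.1 = 0 then edgeLength (min (T.spineWeight e.2) (t + 1 - 2 * T.spineSum e.2))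
  else if e.2 = n + 1 then
    edgeLength (min (T.spineWeight e.1) (2 * T.spineSum (e.1 + 1) - 1 - t))
  else T.len e

theorem slideLen_nonCross (T : Assoc n) (t : ℝ≥0) (e e' : ℕ × ℕ) (he : IsInner (n + 1) e)
    (he' : IsInner (n + 1) e') (h : T.slideLen t e ≠ 0) (h' : T.slideLen t e' ≠ 0) :
    NonCross e e' := by
  have hT := len_nonCross T
  have hw : ∀ b, b ≠ 1 → b ≠ n → 0 < T.spineWeight b → T.len (0, b) ≠ 0 := by
    intro b h1 hn hb h0
    rw [spineWeight_of_ne T h1 hn, h0] at hb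
    exact lt_irrefl _ hb
  -- the new root is not both behind an edge of the spine and ahead of a lower one
  have cross : ∀ a b, 0 < t + 1 - 2 * T.spineSum b → 0 < 2 * T.spineSum (a + 1) - 1 - t →
      b ≤ a := by
    intro a b h1 h2
    by_contra hc
    have := T.spineSum_mono (show a + 1 ≤ b by omega)
    linarith
  obtain ⟨a, b⟩ := e
  obtain ⟨a', b'⟩ := e'
  unfold slideLen at h h'
  unfold IsInner at he he'
  unfold NonCross at hT ⊢
  dsimp only at *
  split_ifs at h h' with h1 h2 h3 h4 h5 h6 h7
  · omega
  · have := cross _ _ (lt_min_iff.1 (pos_of_edgeLength_ne_zero h)).2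
      (lt_min_iff.1 (pos_of_edgeLength_ne_zero h')).2
    omega
  · by_cases hb : b = n
    · omega
    · have := hT _ _ (hw b (by omega) hb (lt_min_iff.1 (pos_of_edgeLength_ne_zero h)).1) h'
      dsimp only at this
      omega
  · have := cross _ _ (lt_min_iff.1 (pos_of_edgeLength_ne_zero h')).2
      (lt_min_iff.1 (pos_of_edgeLength_ne_zero h)).2
    omega
  · omega
  · by_cases ha : a = 1
    · omega
    · have := hT _ _ (hw a ha (by omega) (lt_min_iff.1 (pos_of_edgeLength_ne_zero h)).1) h'
      dsimp only at this
      omega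
  · by_cases hb : b' = n
    · omega
    · have := hT _ _ (hw b' (by omega) hb (lt_min_iff.1 (pos_of_edgeLength_ne_zero h')).1) h
      dsimp only at this
      omega
  · by_cases ha : a' = 1
    · omega
    · have := hT _ _ (hw a' ha (by omega) (lt_min_iff.1 (pos_of_edgeLength_ne_zero h')).1) h
      dsimp only at this
      omega
  · exact hT _ _ h h'

/-- The sliding path of a metric tree `T`, with the edge lengths `slideLen`. -/
noncomputable def slide (n : ℕ) (T : Assoc n) (t : ℝ≥0) : Assoc (n + 1) :=
  ofLen (n + 1) (T.slideLen t) (T.slideLen_nonCross t)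

theorem len_slide (T : Assoc n) (t : ℝ≥0) (e : ℕ × ℕ) :
    (slide n T t).len e = if IsInner (n + 1) e then T.slideLen t e else 0 :=
  len_ofLen _ e

theorem len_slide_left (T : Assoc n) (t : ℝ≥0) {b : ℕ} (h : 2 ≤ b) (hb : b ≤ n) :
    (slide n T t).len (0, b) =
      edgeLength (min (T.spineWeight b) (t + 1 - 2 * T.spineSum b)) := by
  rw [len_slide, if_pos (by unfold IsInner; dsimp only; omega), slideLen, if_pos rfl]

theorem len_slide_right (T : Assoc n) (t : ℝ≥0) {a : ℕ} (h : 1 ≤ a) (ha : a < n) :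
    (slide n T t).len (a, n + 1) =
      edgeLength (min (T.spineWeight a) (2 * T.spineSum (a + 1) - 1 - t)) := by
  rw [len_slide, if_pos (by unfold IsInner; dsimp only; omega), slideLen,
    if_neg (by dsimp only; omega), if_pos rfl]

theorem len_slide_middle (T : Assoc n) (t : ℝ≥0) {a b : ℕ} (h : 1 ≤ a) (hb : b ≤ n) :
    (slide n T t).len (a, b) = T.len (a, b) := by
  rw [len_slide]
  split_ifs with hi
  · rw [slideLen, if_neg (by dsimp only; omega), if_neg (by dsimp only; omega)]
  · exact (T.len_of_not_inner fun h' => hi (by unfold IsInner at *; dsimp only at *; omega)).symm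

theorem continuous_slide (n : ℕ) : Continuous fun p : Assoc n × ℝ≥0 => slide n p.1 p.2 := by
  rw [(isClosedEmbedding_len (n + 1)).isInducing.continuous_iff, continuous_pi_iff]
  intro e
  simp only [Function.comp_def, len_slide, slideLen]
  have hw := fun b => (continuous_spineWeight (n := n) b).comp (continuous_fst (Y := ℝ≥0))
  have hs := fun b => (continuous_spineSum (n := n) b).comp (continuous_fst (Y := ℝ≥0))
  have ht : Continuous fun p : Assoc n × ℝ≥0 => (p.2 : ℝ) :=
    NNReal.continuous_coe.comp continuous_snd
  split_ifs
  · exact continuous_edgeLength.comp ((hw _).min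
      ((ht.add continuous_const).sub (continuous_const.mul (hs _))))
  · exact continuous_edgeLength.comp ((hw _).min
      (((continuous_const.mul (hs _)).sub continuous_const).sub ht))
  · exact (continuous_apply _).comp ((continuous_len n).comp continuous_fst)
  · exact continuous_const

/-- An equality of trees with `n + 1` leaves may be checked on the three kinds of edges which
occur in `slide`. -/
theorem ext_slide {S T : Assoc (n + 1)} (hl : ∀ b, 2 ≤ b → b ≤ n → S.len (0, b) = T.len (0, b))
    (hr : ∀ a, 1 ≤ a → a < n → S.len (a, n + 1) = T.len (a, n + 1))
    (hm : ∀ a b, 1 ≤ a → a + 2 ≤ b → b ≤ n → S.len (a, b) = T.len (a, b)) : S = T := by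
  refine ext fun e => ?_
  by_cases he : IsInner (n + 1) e
  · obtain ⟨a, b⟩ := e
    unfold IsInner at he
    dsimp only at he
    rcases Nat.eq_zero_or_pos a with rfl | ha
    · exact hl b (by omega) (by omega)
    · by_cases hb : b = n + 1
      · subst hb
        exact hr a ha (by omega)
      · exact hm a b ha (by omega) (by omega)
  · rw [len_of_not_inner S he, len_of_not_inner T he]

/-! ### The ends of the sliding paths -/

theorem len_graft_of_inner (h : N + 1 = n + m) (hm : m ≠ 0) (r : unitInterval) (i : Fin n)
    (ρ : Assoc n) (τ : Assoc m) {e : ℕ × ℕ} (he : IsInner N e) :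
    (graft h r i ρ τ).len e = graftLen m i r ρ.len τ.len e := by
  rw [len_graft, if_pos he, if_neg hm]

theorem graftLen_apply (m i : ℕ) (r : unitInterval) (L L' : ℕ × ℕ → unitInterval) (a b : ℕ) :
    graftLen m i r L L' (a, b) =
      if i ≤ a ∧ b ≤ i + m then if a = i ∧ b = i + m then r else L' (a - i, b - i)
      else if b ≤ i ∨ i + m ≤ a ∨ (a ≤ i ∧ i + m ≤ b) then
        L (if a ≤ i then a else a + 1 - m, if b ≤ i then b else b + 1 - m)
      else 0 := rfl

theorem edgeLength_spineWeight (T : Assoc n) {b : ℕ} (h1 : b ≠ 1) (hn : b ≠ n) :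
    edgeLength (T.spineWeight b) = T.len (0, b) := by
  rw [spineWeight_of_ne T h1 hn, edgeLength_coe]

theorem len_deshift_last (T : Assoc n) {a : ℕ} (ha : 1 ≤ a) (h : a + 2 ≤ n) :
    T.deshift.len (a, n) = T.len (0, a + 1) := by
  rw [deshift, len_ofLen, if_pos (by unfold IsInner; dsimp only; omega), if_neg (lt_irrefl n)]

theorem len_deshift_of_lt (T : Assoc n) {a b : ℕ} (hb : b < n) :
    T.deshift.len (a, b) = T.len (a + 1, b + 1) := by
  rw [deshift, len_ofLen]
  split_ifs with hi
  · rfl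
  · exact (T.len_of_not_inner fun h => hi (by unfold IsInner at *; dsimp only at *; omega)).symm

theorem slide_zero (hn : 2 ≤ n) (T : Assoc n) :
    slide n T 0 = graft (by omega) 1 1 (corolla 2) T.deshift := by
  refine ext_slide (fun b h hb => ?_) (fun a h ha => ?_) (fun a b h hab hb => ?_)
  all_goals
    rw [len_graft_of_inner _ (by omega) _ _ _ _ (by unfold IsInner; dsimp only; omega), Fin.val_one,
      graftLen_apply]
    simp only [len_corolla, ite_self]
  · rw [len_slide_left T 0 h hb, if_neg (by omega), edgeLength_of_nonpos]
    have := T.one_le_spineSum (by omega) h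
    refine min_le_iff.2 (Or.inr ?_)
    rw [NNReal.coe_zero]
    linarith
  · rw [len_slide_right T 0 h ha, if_pos (by omega), NNReal.coe_zero]
    have h2 := T.one_le_spineSum (by omega) (show 2 ≤ a + 1 by omega)
    by_cases h1 : a = 1
    · subst h1
      rw [if_pos (by omega), edgeLength_of_one_le]
      rw [spineWeight_one]
      exact le_min le_rfl (by linarith)
    · have h3 := T.one_le_spineSum (by omega) (show 2 ≤ a by omega)
      have h4 := T.spineWeight_nonneg a
      rw [if_neg (by omega), min_eq_left (by rw [spineSum_succ]; linarith),
        edgeLength_spineWeight T h1 ha.ne, Nat.add_sub_cancel,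
        len_deshift_last T (by omega) (by omega),
        Nat.sub_add_cancel h]
  · rw [len_slide_middle T 0 h hb, if_pos (by omega), if_neg (by omega),
      len_deshift_of_lt T (by omega), Nat.sub_add_cancel h, Nat.sub_add_cancel (by omega)]

/-- Once the new root has reached the edge of the old root, the path is stationary. -/
theorem slide_of_length_le (hn : 2 ≤ n) (T : Assoc n) {t : ℝ≥0} (ht : T.length ≤ t) :
    slide n T t = graft (by omega) 1 0 (corolla 2) T := by
  have ht' : 2 * T.spineSum n ≤ t := by
    rw [← length_eq_spineSum T hn]
    exact_mod_cast ht
  refine ext_slide (fun b h hb => ?_) (fun a h ha => ?_) (fun a b h hab hb => ?_)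
  all_goals
    rw [len_graft_of_inner _ (by omega) _ _ _ _ (by unfold IsInner; dsimp only; omega),
      Fin.val_zero, graftLen_apply]
  · rw [len_slide_left T t h hb, if_pos (by omega)]
    have h2 := T.spineSum_mono hb
    have h3 := T.spineWeight_le_one b
    rw [min_eq_left (by linarith)]
    by_cases h1 : b = n
    · subst h1
      rw [if_pos (by omega), spineWeight_last, edgeLength_of_one_le le_rfl]
    · rw [if_neg (by omega), edgeLength_spineWeight T (by omega) h1]
      rfl
  · have h2 := T.spineSum_mono (show a + 1 ≤ n by omega)
    rw [len_slide_right T t h ha, if_neg (by omega), len_corolla, ite_self, edgeLength_of_nonpos]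
    exact min_le_iff.2 (Or.inr (by linarith))
  · rw [len_slide_middle T t h hb, if_pos (by omega), if_neg (by omega)]
    rfl

/-! ### Sliding and grafting -/

section GraftPos

variable (h : N + 1 = n + m) (hm : 2 ≤ m) (i : Fin n) (hi : 0 < (i : ℕ)) (ρ : Assoc n) (τ : Assoc m)
include hm hi

theorem spineWeight_graft_of_le {b : ℕ} (hb : b ≤ i) :
    (graft h 1 i ρ τ).spineWeight b = ρ.spineWeight b := by
  have := i.2
  by_cases h1 : b = 1
  · subst h1
    rw [spineWeight_one, spineWeight_one]
  · rw [spineWeight_of_ne _ h1 (by omega), spineWeight_of_ne _ h1 (by omega)]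
    by_cases h2 : 2 ≤ b
    · rw [len_graft_of_inner h (by omega) _ _ _ _ (by unfold IsInner; dsimp only; omega),
        graftLen_apply, if_neg (by omega), if_pos (by omega), if_pos (by omega), if_pos hb]
    · rw [len_of_not_inner _ (by unfold IsInner; dsimp only; omega),
        len_of_not_inner _ (by unfold IsInner; dsimp only; omega)]

theorem spineWeight_graft_of_mem {b : ℕ} (hb : i < b) (hb' : b < i + m) :
    (graft h 1 i ρ τ).spineWeight b = 0 := by
  have := i.2
  rw [spineWeight_of_ne _ (by omega) (by omega),
    len_graft_of_inner h (by omega) _ _ _ _ (by unfold IsInner; dsimp only; omega), graftLen_apply,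
    if_neg (by omega), if_neg (by omega)]
  rfl

theorem spineWeight_graft_of_ge {b : ℕ} (hb : i + m ≤ b) :
    (graft h 1 i ρ τ).spineWeight b = ρ.spineWeight (b + 1 - m) := by
  have := i.2
  by_cases hN : b = N
  · subst hN
    rw [spineWeight_last, show b + 1 - m = n by omega, spineWeight_last]
  · rw [spineWeight_of_ne _ (by omega) hN, spineWeight_of_ne _ (by omega) (by omega)]
    by_cases h2 : b < N
    · rw [len_graft_of_inner h (by omega) _ _ _ _ (by unfold IsInner; dsimp only; omega),
        graftLen_apply, if_neg (by omega), if_pos (by omega), if_pos (by omega), if_neg (by omega)]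
    · rw [len_of_not_inner _ (by unfold IsInner; dsimp only; omega),
        len_of_not_inner _ (by unfold IsInner; dsimp only; omega)]

/-- The spine of a tree grafted on a leaf other than the first one is renumbered: nothing happens
up to the leaf `i`, the blocks that would cut the grafted tree have weight `0`, and the others
are shifted. -/
theorem spineSum_graft (b : ℕ) : (graft h 1 i ρ τ).spineSum b =
    ρ.spineSum (if b ≤ i + 1 then b else if b ≤ i + m then i + 1 else b + 1 - m) := by
  induction b with
  | zero => simp [spineSum_zero]
  | succ b ih =>
    rw [spineSum_succ, ih]
    rcases le_or_gt b i with h1 | h1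
    · rw [spineWeight_graft_of_le h hm i hi ρ τ h1, if_pos (by omega), if_pos (by omega),
        spineSum_succ]
    · rcases lt_or_ge b (i + m) with h2 | h2
      · rw [spineWeight_graft_of_mem h hm i hi ρ τ h1 h2, add_zero]
        congr 1
        split_ifs <;> omega
      · rw [spineWeight_graft_of_ge h hm i hi ρ τ h2, if_neg (c := b + 1 ≤ i + 1) (by omega),
          if_neg (c := b + 1 ≤ i + m) (by omega), show b + 1 + 1 - m = (b + 1 - m) + 1 by omega,
          spineSum_succ]
        congr 2
        split_ifs <;> omega

theorem length_graft_of_pos : (graft h 1 i ρ τ).length = ρ.length := by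
  have := i.2
  refine NNReal.coe_injective ?_
  rw [length_eq_spineSum _ (by omega), length_eq_spineSum _ (by omega),
    spineSum_graft h hm i hi]
  congr 2
  split_ifs <;> omega

theorem slide_graft_of_pos (t : ℝ≥0) : slide N (graft h 1 i ρ τ) t =
    graft (by omega) 1 i.castSucc (slide n ρ t) τ := by
  have hin := i.2
  refine ext_slide (fun b hb hbN => ?_) (fun a ha haN => ?_) (fun a b ha hab hb => ?_)
  all_goals
    rw [len_graft_of_inner _ (by omega) _ _ _ _ (by unfold IsInner; dsimp only; omega),
      Fin.val_castSucc, graftLen_apply]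
  · rw [len_slide_left _ t hb hbN, if_neg (by omega), spineSum_graft h hm i hi]
    rcases le_or_gt b i with h1 | h1
    · rw [spineWeight_graft_of_le h hm i hi ρ τ h1, if_pos (by omega), if_pos (by omega),
        if_pos (by omega), if_pos h1, len_slide_left _ t hb (by omega)]
    · rcases lt_or_ge b (i + m) with h2 | h2
      · rw [spineWeight_graft_of_mem h hm i hi ρ τ h1 h2, if_neg (c := _ ∨ _) (by omega)]
        exact edgeLength_of_nonpos (min_le_left _ _)
      · rw [spineWeight_graft_of_ge h hm i hi ρ τ h2, if_pos (c := _ ∨ _) (by omega),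
          if_pos (c := 0 ≤ (i : ℕ)) (by omega), if_neg (c := b ≤ (i : ℕ)) (by omega),
          len_slide_left _ t (by omega) (by omega)]
        congr 5
        split_ifs <;> omega
  · rw [len_slide_right _ t ha haN, if_neg (by omega), spineSum_graft h hm i hi]
    rcases le_or_gt a i with h1 | h1
    · rw [spineWeight_graft_of_le h hm i hi ρ τ h1, if_pos (by omega), if_pos (by omega),
        if_pos (by omega), if_neg (by omega), show N + 1 + 1 - m = n + 1 by omega,
        len_slide_right _ t ha (by omega)]
    · rcases lt_or_ge a (i + m) with h2 | h2
      · rw [spineWeight_graft_of_mem h hm i hi ρ τ h1 h2, if_neg (c := _ ∨ _) (by omega)]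
        exact edgeLength_of_nonpos (min_le_left _ _)
      · rw [spineWeight_graft_of_ge h hm i hi ρ τ h2, if_pos (c := _ ∨ _) (by omega),
          if_neg (c := a ≤ (i : ℕ)) (by omega), if_neg (c := N + 1 ≤ (i : ℕ)) (by omega),
          show N + 1 + 1 - m = n + 1 by omega, len_slide_right _ t (by omega) (by omega)]
        congr 6
        split_ifs <;> omega
  · rw [len_slide_middle _ t ha hb,
      len_graft_of_inner h (by omega) _ _ _ _ (by unfold IsInner; dsimp only; omega),
      graftLen_apply]
    split_ifs <;> first | rfl | exact (len_slide_middle _ t (by omega) (by omega)).symm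

end GraftPos

section GraftZero

variable (h : N + 1 = n + m) (hn : 2 ≤ n) (hm : 2 ≤ m) (ρ : Assoc n) (τ : Assoc m)
include hm

theorem spineWeight_graft_zero_of_le {b : ℕ} (hb : b ≤ m) :
    (graft h 1 ⟨0, by omega⟩ ρ τ).spineWeight b = τ.spineWeight b := by
  by_cases h1 : b = 1
  · subst h1
    rw [spineWeight_one, spineWeight_one]
  · by_cases h2 : b = m
    · subst h2
      rw [spineWeight_last, spineWeight_of_ne _ h1 (by omega),
        len_graft_of_inner h (by omega) _ _ _ _ (by unfold IsInner; dsimp only; omega),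
        graftLen_apply]
      simp
    · rw [spineWeight_of_ne _ h1 (by omega), spineWeight_of_ne _ h1 h2]
      by_cases h3 : 2 ≤ b
      · rw [len_graft_of_inner h (by omega) _ _ _ _ (by unfold IsInner; dsimp only; omega),
          graftLen_apply, if_pos (by dsimp only; omega), if_neg (by dsimp only; omega)]
        rfl
      · rw [len_of_not_inner _ (by unfold IsInner; dsimp only; omega),
          len_of_not_inner _ (by unfold IsInner; dsimp only; omega)]

theorem spineWeight_graft_zero_of_ge {b : ℕ} (hb : m ≤ b) :
    (graft h 1 ⟨0, by omega⟩ ρ τ).spineWeight b = ρ.spineWeight (b + 1 - m) := by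
  by_cases h2 : b = m
  · subst h2
    rw [spineWeight_graft_zero_of_le h hn hm ρ τ le_rfl, spineWeight_last, Nat.add_sub_cancel_left,
      spineWeight_one]
  · by_cases hN : b = N
    · subst hN
      rw [spineWeight_last, show b + 1 - m = n by omega, spineWeight_last]
    · rw [spineWeight_of_ne _ (by omega) hN, spineWeight_of_ne _ (by omega) (by omega)]
      by_cases h3 : b < N
      · rw [len_graft_of_inner h (by omega) _ _ _ _ (by unfold IsInner; dsimp only; omega),
          graftLen_apply, if_neg (by dsimp only; omega), if_pos (by dsimp only; omega),
          if_pos (by dsimp only; omega), if_neg (by dsimp only; omega)]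
      · rw [len_of_not_inner _ (by unfold IsInner; dsimp only; omega),
          len_of_not_inner _ (by unfold IsInner; dsimp only; omega)]

theorem spineSum_graft_zero_of_le {b : ℕ} (hb : b ≤ m + 1) :
    (graft h 1 ⟨0, by omega⟩ ρ τ).spineSum b = τ.spineSum b :=
  Finset.sum_congr rfl fun c hc => by
    rw [Finset.mem_range] at hc
    exact spineWeight_graft_zero_of_le h hn hm ρ τ (by omega)

/-- The spine of `ρ` follows that of `τ`, the edge `m` of the spine of `τ` being the edge `1` of
that of `ρ`. -/
theorem spineSum_graft_zero_of_ge {b : ℕ} (hb : m ≤ b) :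
    (graft h 1 ⟨0, by omega⟩ ρ τ).spineSum b = τ.spineSum m + ρ.spineSum (b + 1 - m) := by
  induction b, hb using Nat.le_induction with
  | base =>
    rw [spineSum_graft_zero_of_le h hn hm ρ τ (by omega), Nat.add_sub_cancel_left,
      spineSum_one _ (by omega), add_zero]
  | succ b hb ih =>
    rw [spineSum_succ, ih, show b + 1 + 1 - m = (b + 1 - m) + 1 by omega, spineSum_succ,
      spineWeight_graft_zero_of_ge h hn hm ρ τ hb, add_assoc]

theorem length_graft_zero :
    (graft h 1 ⟨0, by omega⟩ ρ τ).length = τ.length + ρ.length := by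
  refine NNReal.coe_injective ?_
  rw [NNReal.coe_add, length_eq_spineSum _ (by omega), length_eq_spineSum _ hm,
    length_eq_spineSum _ hn, spineSum_graft_zero_of_ge h hn hm ρ τ (by omega),
    show N + 1 - m = n by omega, mul_add]

/-- The first part of the juxtaposition, during which the new root is above the middle of the
grafting edge, so that the part of this edge below the root has length `1`. -/
theorem slide_graft_zero_of_le {t : ℝ≥0} (ht : t ≤ τ.length) :
    slide N (graft h 1 ⟨0, by omega⟩ ρ τ) t =
      graft (by omega) 1 (Fin.last m) (slide m τ t) ρ.deshift := by
  have ht' : (t : ℝ) ≤ 2 * τ.spineSum m := by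
    rw [← length_eq_spineSum τ hm]
    exact_mod_cast ht
  refine ext_slide (fun b hb hbN => ?_) (fun a ha haN => ?_) (fun a b ha hab hb => ?_)
  all_goals
    rw [len_graft_of_inner _ (by omega) _ _ _ _ (by unfold IsInner; dsimp only; omega),
      Fin.val_last, graftLen_apply]
  · rw [len_slide_left _ t hb hbN, if_neg (by omega)]
    by_cases h1 : b ≤ m
    · rw [if_pos (by omega), if_pos (by omega), if_pos h1, len_slide_left _ t hb h1,
        spineSum_graft_zero_of_le h hn hm ρ τ (by omega),
          spineWeight_graft_zero_of_le h hn hm ρ τ h1]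
    · rw [if_neg (by omega), spineSum_graft_zero_of_ge h hn hm ρ τ (by omega)]
      have := ρ.one_le_spineSum (by omega) (show 2 ≤ b + 1 - m by omega)
      exact edgeLength_of_nonpos (min_le_iff.2 (Or.inr (by linarith)))
  · rw [len_slide_right _ t ha haN]
    by_cases h1 : m ≤ a
    · rw [spineSum_graft_zero_of_ge h hn hm ρ τ (by omega),
        spineWeight_graft_zero_of_ge h hn hm ρ τ h1, show a + 1 + 1 - m = (a + 1 - m) + 1 by omega,
        if_pos (by omega)]
      by_cases h2 : a = m
      · subst h2
        rw [if_pos (by omega), Nat.add_sub_cancel_left, spineSum_two _ (by omega), spineWeight_one]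
        exact edgeLength_of_one_le (le_min le_rfl (by linarith))
      · have h3 := ρ.one_le_spineSum (by omega) (show 2 ≤ a + 1 - m by omega)
        have h4 := ρ.spineWeight_nonneg (a + 1 - m)
        rw [if_neg (by omega), spineSum_succ, min_eq_left (by linarith),
          edgeLength_spineWeight ρ (by omega) (by omega), show N + 1 - m = n by omega,
          len_deshift_last ρ (by omega) (by omega), show a - m + 1 = a + 1 - m by omega]
    · rw [if_neg (by omega), if_pos (by omega), if_pos (by omega), if_neg (by omega),
        show N + 1 + 1 - n = m + 1 by omega, len_slide_right _ t ha (by omega),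
        spineSum_graft_zero_of_le h hn hm ρ τ (by omega),
        spineWeight_graft_zero_of_le h hn hm ρ τ (by omega)]
  · rw [len_slide_middle _ t ha hb,
      len_graft_of_inner h (by omega) _ _ _ _ (by unfold IsInner; dsimp only; omega),
      graftLen_apply]
    dsimp only
    by_cases h1 : m ≤ a
    · rw [if_neg (by omega), if_pos (by omega), if_neg (by omega), if_neg (by omega),
        if_pos (by omega), if_neg (by omega), len_deshift_of_lt _ (by omega),
        show a - m + 1 = a + 1 - m by omega, show b - m + 1 = b + 1 - m by omega]
    · by_cases h2 : b ≤ m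
      · rw [if_pos (by omega), if_neg (by omega), if_neg (by omega), if_pos (by omega),
          if_pos (by omega), if_pos h2, len_slide_middle _ t ha h2]
        rfl
      · rw [if_neg (by omega), if_neg (by omega), if_neg (by omega), if_neg (by omega)]

/-- The second part of the juxtaposition, during which the new root is below the middle of the
grafting edge, so that the part of this edge above the root has length `1`. -/
theorem slide_graft_zero_of_lt {t : ℝ≥0} (ht : τ.length < t) :
    slide N (graft h 1 ⟨0, by omega⟩ ρ τ) t =
      graft (by omega) 1 0 (slide n ρ (t - τ.length)) τ := by
  have hl := length_eq_spineSum τ hm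
  have ht' : 2 * τ.spineSum m < t := by
    rw [← hl]
    exact_mod_cast ht
  have hs : ((t - τ.length : ℝ≥0) : ℝ) = t - 2 * τ.spineSum m := by
    rw [NNReal.coe_sub ht.le, hl]
  refine ext_slide (fun b hb hbN => ?_) (fun a ha haN => ?_) (fun a b ha hab hb => ?_)
  all_goals
    rw [len_graft_of_inner _ (by omega) _ _ _ _ (by unfold IsInner; dsimp only; omega),
      Fin.val_zero, graftLen_apply]
  · rw [len_slide_left _ t hb hbN]
    by_cases h1 : b ≤ m
    · rw [spineSum_graft_zero_of_le h hn hm ρ τ (by omega),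
          spineWeight_graft_zero_of_le h hn hm ρ τ h1,
        if_pos (by omega)]
      have h2 := τ.spineSum_mono h1
      have h3 := τ.spineWeight_le_one b
      rw [min_eq_left (by linarith)]
      by_cases h4 : b = m
      · subst h4
        rw [if_pos (by omega), spineWeight_last, edgeLength_of_one_le le_rfl]
      · rw [if_neg (by omega), edgeLength_spineWeight τ (by omega) h4]
        rfl
    · rw [if_neg (by omega), if_pos (by omega), if_pos (by omega), if_neg (by omega),
        len_slide_left _ _ (by omega) (by omega), hs,
        spineSum_graft_zero_of_ge h hn hm ρ τ (by omega),
        spineWeight_graft_zero_of_ge h hn hm ρ τ (by omega)]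
      congr 2
      ring
  · rw [len_slide_right _ t ha haN, if_neg (by omega)]
    by_cases h1 : m ≤ a
    · rw [spineSum_graft_zero_of_ge h hn hm ρ τ (by omega),
        spineWeight_graft_zero_of_ge h hn hm ρ τ h1, if_pos (by omega), if_neg (by omega),
        if_neg (by omega), show N + 1 + 1 - m = n + 1 by omega,
        len_slide_right _ _ (by omega) (by omega), hs,
        show a + 1 + 1 - m = (a + 1 - m) + 1 by omega]
      congr 2
      ring
    · have := τ.spineSum_mono (show a + 1 ≤ m by omega)
      rw [if_neg (by omega), spineSum_graft_zero_of_le h hn hm ρ τ (by omega)]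
      exact edgeLength_of_nonpos (min_le_iff.2 (Or.inr (by linarith)))
  · rw [len_slide_middle _ t ha hb,
      len_graft_of_inner h (by omega) _ _ _ _ (by unfold IsInner; dsimp only; omega),
      graftLen_apply]
    dsimp only
    split_ifs <;> first | rfl | omega | exact (len_slide_middle _ _ (by omega) (by omega)).symm

end GraftZero

theorem slide_corolla_two (t : ℝ≥0) : slide 2 (corolla 2) t = slideTwo t := by
  have h2 : (corolla 2).spineSum 2 = 1 := spineSum_two _ two_ne_zero
  have hl : (slide 2 (corolla 2) t).len (0, 2) = edgeLength (min 1 (t - 1)) := by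
    rw [len_slide_left _ t le_rfl le_rfl, spineWeight_last, h2]
    congr 2
    ring
  have hr : (slide 2 (corolla 2) t).len (1, 3) = edgeLength (min 1 (1 - t)) := by
    rw [len_slide_right _ t le_rfl one_lt_two, spineWeight_one, h2]
    congr 2
    ring
  have hclip : ∀ r : ℝ, edgeLength (min 1 r) = edgeLength r := by
    intro r
    rcases le_total 1 r with h | h
    · rw [min_eq_left h, edgeLength_of_one_le h, edgeLength_of_one_le le_rfl]
    · rw [min_eq_right h]
  rw [hclip] at hl hr
  have hg : ∀ (i : Fin 2) (r : unitInterval) (e : ℕ × ℕ), IsInner 3 e →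
      (graft (n := 2) (m := 2) (N := 3) rfl r i (corolla 2) (corolla 2)).len e =
        if e = ((i : ℕ), (i : ℕ) + 2) then r else 0 := by
    rintro i r ⟨a, b⟩ he
    rw [len_graft_of_inner _ two_ne_zero _ _ _ _ he, graftLen_apply]
    simp only [len_corolla, ite_self, Prod.mk.injEq]
    split_ifs <;> first | rfl | omega
  unfold slideTwo
  refine ext_slide (fun b h hb => ?_) (fun a h ha => ?_) (fun a b h hab hb => ?_)
  · obtain rfl : b = 2 := by omega
    rw [hl]
    split_ifs with ht
    · rw [hg _ _ _ (by unfold IsInner; decide), edgeLength_of_nonpos (by linarith)]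
      rfl
    · rw [hg _ _ _ (by unfold IsInner; decide)]
      rfl
  · obtain rfl : a = 1 := by omega
    rw [hr]
    split_ifs with ht
    · rw [hg _ _ _ (by unfold IsInner; decide)]
      rfl
    · rw [hg _ _ _ (by unfold IsInner; decide), edgeLength_of_nonpos (by linarith)]
      rfl
  · omega

theorem isSlidingFamily_slide : IsSlidingFamily slide where
  continuous n _ := continuous_slide n
  stationary n hn T t ht := by
    rw [slide_of_length_le hn T ht, slide_of_length_le hn T le_rfl]
  source n hn T := slide_zero hn T
  target n hn T := slide_of_length_le hn T le_rfl
  graft_of_pos h _ hm i hi T₁ T₂ t := slide_graft_of_pos h hm i hi T₁ T₂ t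
  graft_zero h hn hm T₁ T₂ t := by
    split_ifs with ht
    · exact slide_graft_zero_of_le h hn hm T₁ T₂ ht
    · exact slide_graft_zero_of_lt h hn hm T₁ T₂ (not_le.1 ht)
  two := slide_corolla_two

end Assoc

/-! ### Loops in the classifying space -/

namespace ClassifyingSpace

variable {X : Type u} [TopologicalSpace X] [AInfinitySpace X]

theorem mk_graft_zero {p m N : ℕ} (h : N + 1 = p + m) (hm : 1 ≤ m) (ρ : Assoc (p + 2))
    (τ : Assoc m) (x : Fin N → X) :
    mk (Assoc.graft (by omega) 1 0 ρ τ) x = mk ρ fun j => x ⟨j + m - 1, by omega⟩ :=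
  Quot.sound (BarRel.left h hm ρ τ x)

theorem mk_graft_middle {p m N : ℕ} (h : N + 1 = p + m) (hm : 1 ≤ m) (i : Fin p)
    (ρ : Assoc (p + 2)) (τ : Assoc m) (x : Fin N → X) :
    mk (Assoc.graft (by omega) 1 i.succ.castSucc ρ τ) x =
      mk ρ (plug h i (AInfinitySpace.M m τ) x) :=
  Quot.sound (BarRel.middle h hm i ρ τ x)

theorem mk_graft_last {p m N : ℕ} (h : N + 1 = p + m) (hm : 1 ≤ m) (ρ : Assoc (p + 2))
    (τ : Assoc m) (x : Fin N → X) :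
    mk (Assoc.graft (by omega) 1 (Fin.last (p + 1)) ρ τ) x = mk ρ fun j => x ⟨j, by omega⟩ :=
  Quot.sound (BarRel.right h hm ρ τ x)

theorem mk_corolla_two (x : Fin 0 → X) : mk (Assoc.corolla 2) x = base X :=
  congrArg (mk (Assoc.corolla 2)) (Subsingleton.elim _ _)

/-- The classes `[T; *, x, *]` depend continuously on a parameter in a compactly generated space
when `T` and `x` do, although `K (n + 2) × X ^ n` carries the compactly generated topology in the
definition of the classifying space. -/
theorem continuous_mk_comp {Z : Type v} [TopologicalSpace Z] [UCompactlyGeneratedSpace.{u} Z]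
    {n : ℕ} {T : Z → Assoc (n + 2)} {x : Z → Fin n → X} (hT : Continuous T) (hx : Continuous x) :
    Continuous fun z => mk (T z) (x z) := by
  refine continuous_from_uCompactlyGeneratedSpace.{u} _ fun S g => ?_
  have h : Continuous[_, TopologicalSpace.compactlyGenerated.{u} _]
      (fun y : S => ((T (g y), x (g y)) : Assoc (n + 2) × (Fin n → X))) :=
    continuous_to_compactlyGenerated
      ((hT.comp g.continuous).prodMk (hx.comp g.continuous))
  have h2 := @Continuous.comp S (Assoc (n + 2) × (Fin n → X)) (BarPre X) _
    (TopologicalSpace.compactlyGenerated.{u} _) inferInstance _ _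
    (@continuous_sigmaMk ℕ (fun n => Assoc (n + 2) × (Fin n → X))
      (fun n => TopologicalSpace.compactlyGenerated.{u} (Assoc (n + 2) × (Fin n → X))) n) h
  have h3 : Continuous (fun p : BarPre X => (Quot.mk _ p : ClassifyingSpace X)) :=
    continuous_quot_mk
  exact h3.comp h2

/-- The loop `t ↦ [slide T t; *, x, *]`, of the length of `T`. -/
noncomputable def slideLoop {n : ℕ} (hn : 1 ≤ n) (T : Assoc (n + 1)) (x : Fin n → X) :
    MooreLoop (ClassifyingSpace X) (base X) where
  path := ⟨fun t => mk (Assoc.slide (n + 1) T t) x,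
    continuous_mk_comp ((Assoc.continuous_slide (n + 1)).comp
      (continuous_const.prodMk continuous_id)) continuous_const⟩
  length := T.length
  stationary t ht := congrArg (mk · x)
    ((Assoc.slide_of_length_le (by omega) T ht).trans
      (Assoc.slide_of_length_le (by omega) T le_rfl).symm)
  source := by
    change mk (Assoc.slide (n + 1) T 0) x = _
    rw [Assoc.slide_zero (by omega) T]
    exact (mk_graft_last (p := 0) (by omega) (by omega) _ _ x).trans (mk_corolla_two _)
  target := by
    change mk (Assoc.slide (n + 1) T T.length) x = _
    rw [Assoc.slide_of_length_le (by omega) T le_rfl]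
    exact (mk_graft_zero (p := 0) (by omega) (by omega) _ _ x).trans (mk_corolla_two _)

theorem slideLoop_path {n : ℕ} (hn : 1 ≤ n) (T : Assoc (n + 1)) (x : Fin n → X) (t : ℝ≥0) :
    (slideLoop hn T x).path t = mk (Assoc.slide (n + 1) T t) x := rfl

theorem continuous_slideLoop_path {S : Type u} [TopologicalSpace S] [CompactSpace S] [T2Space S]
    {n : ℕ} (hn : 1 ≤ n) {T : S → Assoc (n + 1)} {x : S → Fin n → X} (hT : Continuous T)
    (hx : Continuous x) : Continuous fun s => (slideLoop hn (T s) (x s)).path := by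
  refine ContinuousMap.continuous_of_continuous_uncurry _ ?_
  have hs : Continuous fun q : S × ℝ≥0 => Assoc.slide (n + 1) (T q.1) q.2 :=
    (Assoc.continuous_slide (n + 1)).comp (f := fun q : S × ℝ≥0 => (T q.1, q.2))
      ((hT.comp continuous_fst).prodMk continuous_snd)
  exact continuous_mk_comp hs (hx.comp continuous_fst)

theorem kContinuous_slideLoop {n : ℕ} (hn : 1 ≤ n) :
    KContinuous fun p : Assoc (n + 1) × (Fin n → X) => slideLoop hn p.1 p.2 := by
  refine continuous_from_compactlyGenerated _ fun S g => ?_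
  refine continuous_to_compactlyGenerated (t := MooreLoop.preTopology (base X)) ?_
  have hT : Continuous fun s : S => (g s).1 := continuous_fst.comp g.continuous
  have hx : Continuous fun s : S => (g s).2 := continuous_snd.comp g.continuous
  exact continuous_induced_rng.2 ((continuous_slideLoop_path hn hT hx).prodMk
    ((Assoc.continuous_length (by omega)).comp hT))

variable (X)

/-- The loops `slideLoop` as a family over all `n`; for `n = 0` it is the constant loop. -/
noncomputable def slideFamily (n : ℕ) (T : Assoc (n + 1)) (x : Fin n → X) :
    MooreLoop (ClassifyingSpace X) (base X) :=
  if hn : 1 ≤ n then slideLoop hn T x else 1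

variable {X}

theorem slideFamily_of_pos {n : ℕ} (hn : 1 ≤ n) (T : Assoc (n + 1)) (x : Fin n → X) :
    slideFamily X n T x = slideLoop hn T x := dif_pos hn

theorem isAInfinityFamily_slideFamily : IsAInfinityFamily (usualMap X) (slideFamily X) where
  continuous n hn := by
    simp only [slideFamily_of_pos hn]
    exact kContinuous_slideLoop hn
  apply_one x := by
    rw [slideFamily_of_pos le_rfl]
    refine MooreLoop.ext' (fun t => ?_) ?_
    · exact congrArg (mk · _) (Assoc.slide_corolla_two t).symm
    · change 2 = (Assoc.corolla 2).length
      simp [Assoc.length, len_corolla]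
  graft_succ {p m k} h hp hm j ρ τ x := by
    have hk : 1 ≤ k := by omega
    have hj : 0 < (j.succ : ℕ) := Nat.succ_pos _
    rw [slideFamily_of_pos hk, slideFamily_of_pos hp]
    refine MooreLoop.ext' (fun t => ?_) (Assoc.length_graft_of_pos _ hm _ hj ρ τ)
    rw [slideLoop_path, slideLoop_path, Assoc.slide_graft_of_pos (by omega) hm _ hj]
    exact mk_graft_middle h (by omega) j _ τ x
  graft_zero {p q} hp hq ρ τ x := by
    have hk : 1 ≤ q + p := by omega
    rw [slideFamily_of_pos hk, slideFamily_of_pos hp, slideFamily_of_pos hq]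
    refine MooreLoop.ext' (fun t => ?_)
      (Assoc.length_graft_zero (by omega) (by omega) (by omega) ρ τ)
    rw [MooreLoop.mul_path]
    by_cases ht : t ≤ τ.length
    · have hs := Assoc.slide_graft_zero_of_le (N := q + p + 1) (by omega) (by omega) (by omega)
        ρ τ ht
      refine Eq.trans ?_ (if_pos ht).symm
      exact (congrArg (mk · x) hs).trans
        (mk_graft_last (p := q) (m := p + 1) (by omega) (by omega) _ _ x)
    · have hs := Assoc.slide_graft_zero_of_lt (N := q + p + 1) (by omega) (by omega) (by omega)
        ρ τ (not_le.1 ht)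
      refine Eq.trans ?_ (if_neg ht).symm
      refine (congrArg (mk · x) hs).trans
        ((mk_graft_zero (p := p) (m := q + 1) (by omega) (by omega) _ _ x).trans ?_)
      refine congrArg (mk _) (funext fun j => congrArg x (Fin.ext ?_))
      simp only [Fin.val_natAdd]
      omega

end ClassifyingSpace

theorem mainTheorem3 (X : Type u) [TopologicalSpace X] [T2Space X] [CompactlyGeneratedSpace X]
    [AInfinitySpace X] :
    IsAInfinityMap (usualMap X) ∧
    ∃ (σ : ∀ n : ℕ, Assoc n → ℝ≥0 → Assoc (n + 1))
      (f : ∀ n : ℕ, Assoc (n + 1) → (Fin n → X) →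
        MooreLoop (ClassifyingSpace X) (ClassifyingSpace.base X)),
      IsSlidingFamily σ ∧ IsAInfinityFamily (usualMap X) f ∧
      ∀ n : ℕ, 1 ≤ n → ∀ (T : Assoc (n + 1)) (x : Fin n → X),
        (f n T x).length = T.length ∧
        ∀ t : ℝ≥0, (f n T x).path t = ClassifyingSpace.mk (σ (n + 1) T t) x := by
  refine ⟨⟨_, ClassifyingSpace.isAInfinityFamily_slideFamily⟩, Assoc.slide,
    ClassifyingSpace.slideFamily X, Assoc.isSlidingFamily_slide,
    ClassifyingSpace.isAInfinityFamily_slideFamily, fun n hn T x => ?_⟩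
  rw [ClassifyingSpace.slideFamily_of_pos hn]
  exact ⟨rfl, fun t => rfl⟩
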